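/- For a positive integer $k$ let $[k]_q := 1+q+\cdots+q^{k-1}\in\mathbb Z[q]$. For a positive integer $n$ and $\alpha\in[0,1]$ let $\mathcal A\subseteq\{1,\dots,n\}$ be a random set to which each element of $\{1,\dots,n\}$ belongs, independently, with probability $\alpha$, and let $X:=\deg\operatorname{lcm}\{[k]_q : k\in\mathcal A\}$, the least common multiple being taken in $\mathbb Z[q]$. For positive integers $a_1,a_2$ the series in $$C_1(a_1,a_2):=\frac{a_1a_2}{3}\sum_{d_1,d_2\ge1}\frac{\mu(d_1)\mu(d_2)}{d_1d_2\,\operatorname{lcm}\!\big(\frac{d_1}{\gcd(a_1,d_1)},\frac{d_2}{\gcd(a_2,d_2)}\big)}$$ is absolutely convergent, where $\mu$ is the Möbius function. For positive integers $a_1,a_2,j_1,j_2,j_3$ put $$\rho_1:=\max\Big(\tfrac1{a_1(j_1+1)},\tfrac1{a_2(j_2+1)},\tfrac1{a_1a_2(j_3+1)}\Big),\qquad \rho_2:=\min\Big(\tfrac1{a_1j_1},\tfrac1{a_2j_2},\tfrac1{a_1a_2j_3}\Big),$$ and let $\mathcal S$ be the set of all $(a_1,a_2,j_1,j_2,j_3)$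 with $\gcd(a_1,a_2)=1$ and $\rho_1<\rho_2$. For every $\alpha\in(0,1)$ the series $$\mathrm v(\alpha):=\sum_{(a_1,a_2,j_1,j_2,j_3)\in\mathcal S}(1-\alpha)^{j_1+j_2-j_3}\big(1-(1-\alpha)^{j_3}\big)\,C_1(a_1,a_2)\,\big(\rho_2^3-\rho_1^3\big)$$ converges absolutely and $\mathrm v(\alpha)>0$. Moreover $$\mathbb V[X]=(\mathrm v(\alpha)+o(1))\,n^3\qquad\text{as}\quad\frac{\alpha n}{(\log n)^3\log\log n}\to+\infty;$$ that is, for every $\varepsilon>0$ there is $K$, depending only on $\varepsilon$, such that $|\mathbb V[X]-\mathrm v(\alpha)n^3|\le\varepsilon n^3$ for all integers $n\ge3$ and all $\alpha\in(0,1)$ with $\alpha n/((\log n)^3\log\log n)\ge K$. Finally, there is an absolute constant $C$ such that $\mathbb V[X]\le C\alpha n^3$ for every positive integer $n$ and every $\alpha\in[0,1]$. -/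

import Mathlib

open MeasureTheory ProbabilityTheory

noncomputable section

namespace QLcm

/-- The `q`-analog `[k]_q = 1 + q + ⋯ + q^(k-1)` of `k`, a polynomial in the indeterminate `q`
with integer coefficients. -/
def qInt (k : ℕ) : Polynomial ℤ := ∑ i ∈ Finset.range k, Polynomial.X ^ i

/-- The least common multiple in `ℤ[q]` of a set of polynomials (the normalized one; it is `1` for
the empty set).  An infinite set of polynomials has no common multiple but `0`. -/
def setLcm (S : Set (Polynomial ℤ)) : Polynomial ℤ :=
  open scoped Classical in if h : S.Finite then h.toFinset.lcm id else 0

/-- The characteristic property of the least common multiple. -/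
theorem setLcm_dvd_iff {S : Set (Polynomial ℤ)} (hS : S.Finite) (p : Polynomial ℤ) :
    setLcm S ∣ p ↔ ∀ s ∈ S, s ∣ p := by
  simp [setLcm, hS]

/-- The degree of `lcm [A]_q`, where `[A]_q = {[k]_q : k ∈ A}`. -/
def degLcm (A : Set ℕ) : ℕ := (setLcm (qInt '' A)).natDegree

/-- The random set `𝒜 : Ω → Set ℕ` follows the model `B(n, α)`: it is a subset of `{1, …, n}` to
which each element of `{1, …, n}` belongs, independently, with probability `α`. -/
def IsModel {Ω : Type*} [MeasurableSpace Ω] (n : ℕ) (α : unitInterval) (𝒜 : Ω → Set ℕ)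
    (P : Measure Ω) : Prop :=
  IsSetBernoulli 𝒜 (Set.Icc 1 n) α P

/-- The term of index `d = (d₁, d₂)` of the double series in `C₁`.  It vanishes if `d₁ = 0` or
`d₂ = 0`, since the Möbius function vanishes at `0`. -/
def C₁Term (a₁ a₂ : ℕ) (d : ℕ × ℕ) : ℝ :=
  ((ArithmeticFunction.moebius d.1 : ℤ) : ℝ) * ((ArithmeticFunction.moebius d.2 : ℤ) : ℝ) /
    ((d.1 : ℝ) * (d.2 : ℝ) *
      ((Nat.lcm (d.1 / Nat.gcd a₁ d.1) (d.2 / Nat.gcd a₂ d.2) : ℕ) : ℝ))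

/-- `C₁(a₁, a₂) = (a₁ a₂ / 3) ∑_{d₁, d₂ ≥ 1} μ(d₁) μ(d₂) / (d₁ d₂ [d₁/(a₁,d₁), d₂/(a₂,d₂)])`. -/
def C₁ (a₁ a₂ : ℕ) : ℝ := (a₁ : ℝ) * (a₂ : ℝ) / 3 * ∑' d : ℕ × ℕ, C₁Term a₁ a₂ d

/-- A vector `(a₁, a₂, j₁, j₂, j₃)` of natural numbers. -/
@[ext]
structure Index where
  a₁ : ℕ
  a₂ : ℕ
  j₁ : ℕ
  j₂ : ℕ
  j₃ : ℕ

/-- `ρ₁ = max(1/(a₁(j₁+1)), 1/(a₂(j₂+1)), 1/(a₁a₂(j₃+1)))`. -/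
def ρ₁ (t : Index) : ℝ :=
  max (1 / ((t.a₁ : ℝ) * (t.j₁ + 1)))
    (max (1 / ((t.a₂ : ℝ) * (t.j₂ + 1))) (1 / ((t.a₁ : ℝ) * t.a₂ * (t.j₃ + 1))))

/-- `ρ₂ = min(1/(a₁j₁), 1/(a₂j₂), 1/(a₁a₂j₃))`. -/
def ρ₂ (t : Index) : ℝ :=
  min (1 / ((t.a₁ : ℝ) * t.j₁)) (min (1 / ((t.a₂ : ℝ) * t.j₂)) (1 / ((t.a₁ : ℝ) * t.a₂ * t.j₃)))

/-- The index set of the series: positive integers `a₁, a₂, j₁, j₂, j₃` with `a₁, a₂` coprime and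
`ρ₁ < ρ₂`. -/
def indexSet : Set Index :=
  {t | 0 < t.a₁ ∧ 0 < t.a₂ ∧ 0 < t.j₁ ∧ 0 < t.j₂ ∧ 0 < t.j₃ ∧ Nat.Coprime t.a₁ t.a₂ ∧
    ρ₁ t < ρ₂ t}

/-- On the index set `j₃ ≤ j₁` and `j₃ ≤ j₂`, so that the subtraction of natural numbers in the
exponent `j₁ + j₂ - j₃` below does not truncate. -/
theorem j₃_le_of_mem {t : Index} (ht : t ∈ indexSet) : t.j₃ ≤ t.j₁ ∧ t.j₃ ≤ t.j₂ := by
  obtain ⟨a₁, a₂, j₁, j₂, j₃⟩ := t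
  obtain ⟨ha₁, ha₂, hj₁, hj₂, hj₃, -, h⟩ := ht
  simp only [ρ₁, ρ₂] at h
  have h₁ := (le_max_left _ _).trans_lt (h.trans_le ((min_le_right _ _).trans (min_le_right _ _)))
  have h₂ := ((le_max_left _ _).trans (le_max_right _ _)).trans_lt
    (h.trans_le ((min_le_right _ _).trans (min_le_right _ _)))
  simp only at ha₁ ha₂ hj₁ hj₂ hj₃ h₁ h₂ ⊢
  have ha₁' : (0 : ℝ) < a₁ := by exact_mod_cast ha₁
  have ha₂' : (0 : ℝ) < a₂ := by exact_mod_cast ha₂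
  have hj₃' : (0 : ℝ) < j₃ := by exact_mod_cast hj₃
  rw [one_div_lt_one_div (by positivity) (by positivity)] at h₁ h₂
  norm_cast at h₁ h₂
  constructor
  · have : a₂ * j₃ < j₁ + 1 := lt_of_mul_lt_mul_left (by linarith) ha₁.le
    nlinarith
  · have : a₁ * j₃ < j₂ + 1 := lt_of_mul_lt_mul_left (by linarith) ha₂.le
    nlinarith

/-- The term `β^(j₁+j₂-j₃) (1 - β^j₃) C₁(a₁, a₂) (ρ₂³ - ρ₁³)`, with `β = 1 - α`, of the series that
defines the limiting normalized variance. -/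
def varTerm (α : ℝ) (t : Index) : ℝ :=
  (1 - α) ^ (t.j₁ + t.j₂ - t.j₃) * (1 - (1 - α) ^ t.j₃) *
    (C₁ t.a₁ t.a₂ * (ρ₂ t ^ 3 - ρ₁ t ^ 3))

end QLcm

end

/-!
Since `[k]_q` is the product of the cyclotomic polynomials `Φ_d` over `d ∣ k`, `d > 1`, the degree of
the least common multiple is the sum of `φ(d)` over the `d > 1` that divide an element of the random
set (`degLcm_eq`).  So it is a constant minus `∑ φ(d) 1_d`, where `1_d` indicates that the set avoids
the multiples of `d`, and its variance is the sum over pairs `(d, e)` of `φ(d) φ(e)` times the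
covariance `β^(j₁+j₂-j₃) (1 - β^j₃)`, with `j₁ = ⌊n/d⌋`, `j₂ = ⌊n/e⌋`, `j₃ = ⌊n/lcm(d,e)⌋`
(`variance_degLcm`).  Only pairs with `lcm(d, e) ≤ n` matter.

Write such a pair as `(a₁ m, a₂ m)` with `a₁`, `a₂` coprime.  The pairs with given `a₁`, `a₂`, `j₁`,
`j₂`, `j₃` are those with `ρ₁ n < m ≤ ρ₂ n` (`fiberSum_eq`).  As `∑_{m ≤ N} φ(a₁ m) φ(a₂ m)` is
asymptotic to `C₁(a₁, a₂) N³` (`tendsto_totientSum`), each index contributes its term of the series,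
times `n³`, in the limit (`tendsto_fiberSum`).

To sum over the indices, group them by `(a₁, a₂, j₃)`.  In such a group `m ≤ n / (a₁ a₂ j₃)`, the
product of totients is at most `a₁ a₂ m²` and the covariance at most `α j₃`, so that the group
contributes at most `α n³ / (a₁ a₂ j₃)²` (`sum_core_le`).  This is summable, which gives the bound
`O(α n³)`.  A group is finite, and the limit in each of its indices does not involve `α`; hence the
sum converges uniformly in `α ∈ [0, 1]` (`pairSum_sub_tsum_le`), and the hypothesis on `α n` is used
only to make `n` large.

The limit is positive because of the index `(1, 1, 1, 1, 1)`, as `C₁(1, 1) > 0`: the mean value of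
`φ(d) / d` is at least `1 / 2` (`le_sum_totient_div`), so `∑_{d ≤ N} φ(d)²` is of order `N³`.
-/

namespace QLcm

/-! ### The degree of the least common multiple -/

theorem qInt_eq_prod_cyclotomic {k : ℕ} (hk : 0 < k) :
    qInt k = ∏ d ∈ k.divisors.erase 1, Polynomial.cyclotomic d ℤ :=
  (Polynomial.prod_cyclotomic_eq_geom_sum hk ℤ).symm

theorem isRelPrime_cyclotomic {d e : ℕ} (hd : 0 < d) (he : 0 < e) (hde : d ≠ e) :
    IsRelPrime (Polynomial.cyclotomic d ℤ) (Polynomial.cyclotomic e ℤ) := by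
  rw [(Polynomial.cyclotomic.irreducible hd).isRelPrime_iff_not_dvd]
  intro h
  have h₁ : Associated (Polynomial.cyclotomic d ℤ) (Polynomial.cyclotomic e ℤ) :=
    ((Polynomial.cyclotomic.irreducible hd).dvd_irreducible_iff_associated
      (Polynomial.cyclotomic.irreducible he)).1 h
  have h₂ := Polynomial.eq_of_monic_of_associated (Polynomial.cyclotomic.monic d ℤ)
    (Polynomial.cyclotomic.monic e ℤ) h₁
  exact hde (Polynomial.cyclotomic_injective h₂)

open scoped Classical in
/-- The least common multiple of `[A]_q` is the product of the cyclotomic polynomials `Φ_d` over the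
`d > 1` that divide some element of `A`. -/
theorem degLcm_eq {n : ℕ} {A : Set ℕ} (hA : A ⊆ Set.Icc 1 n) :
    degLcm A = ∑ d ∈ Finset.Icc 2 n with ∃ k ∈ A, d ∣ k, d.totient := by
  have hfin : (qInt '' A).Finite := ((Set.finite_Icc 1 n).subset hA).image _
  set D : Finset ℕ := {d ∈ Finset.Icc 2 n | ∃ k ∈ A, d ∣ k}
  have h : Associated (setLcm (qInt '' A)) (∏ d ∈ D, Polynomial.cyclotomic d ℤ) := by
    refine associated_of_dvd_dvd ?_ ?_
    · rw [setLcm_dvd_iff hfin]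
      rintro _ ⟨k, hk, rfl⟩
      have hk1 := hA hk
      rw [qInt_eq_prod_cyclotomic hk1.1]
      refine Finset.prod_dvd_prod_of_subset _ _ _ fun d hd => ?_
      simp only [Finset.mem_erase, Nat.mem_divisors] at hd
      have h0 : d ≠ 0 := fun h => hd.2.2 (by simpa [h] using hd.2.1)
      have := Nat.le_of_dvd hk1.1 hd.2.1
      have := hk1.2
      simp only [D, Finset.mem_filter, Finset.mem_Icc]
      exact ⟨⟨by omega, by omega⟩, k, hk, hd.2.1⟩
    · refine Finset.prod_dvd_of_isRelPrime ?_ ?_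
      · intro d hd e he hde
        simp only [D, Finset.coe_filter, Finset.mem_Icc, Set.mem_ofPred_eq] at hd he
        exact isRelPrime_cyclotomic (by omega) (by omega) hde
      · intro d hd
        simp only [D, Finset.mem_filter, Finset.mem_Icc] at hd
        obtain ⟨⟨hd1, -⟩, k, hk, hdk⟩ := hd
        refine dvd_trans ?_ ((setLcm_dvd_iff hfin _).1 dvd_rfl _ ⟨k, hk, rfl⟩)
        rw [qInt_eq_prod_cyclotomic (hA hk).1]
        refine Finset.dvd_prod_of_mem _ ?_
        simp only [Finset.mem_erase, Nat.mem_divisors]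
        exact ⟨by omega, hdk, by have := (hA hk).1; omega⟩
  have h1 : degLcm A = (∏ d ∈ D, Polynomial.cyclotomic d ℤ).natDegree :=
    Polynomial.natDegree_eq_of_degree_eq (Polynomial.degree_eq_degree_of_associated h)
  rw [h1, Polynomial.natDegree_prod_of_monic _ _ fun d _ => Polynomial.cyclotomic.monic d ℤ]
  exact Finset.sum_congr rfl fun d _ => Polynomial.natDegree_cyclotomic d ℤ

/-! ### The variance as a double sum of covariances -/

/-- The event that a random set of natural numbers avoids `M`. -/
def avoid (M : Finset ℕ) : Set (Set ℕ) := {s | ∀ i ∈ M, i ∉ s}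

theorem measurableSet_avoid (M : Finset ℕ) : MeasurableSet (avoid M) := by
  have : avoid M = ⋂ i ∈ M, {s : Set ℕ | i ∈ s}ᶜ := by ext; simp [avoid]
  rw [this]
  exact Finset.measurableSet_biInter _ fun i _ => (measurableSet_setOfPred.2 (by fun_prop)).compl

theorem memLp_indicator_avoid (M : Finset ℕ) (μ : Measure (Set ℕ)) [IsProbabilityMeasure μ] :
    MemLp ((avoid M).indicator (1 : Set ℕ → ℝ)) 2 μ :=
  (memLp_const 1).indicator (measurableSet_avoid M)

open unitInterval in
theorem setBernoulli_real_avoid {n : ℕ} (α : I) {M : Finset ℕ} (hM : M ⊆ Finset.Icc 1 n) :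
    (setBernoulli (Set.Icc 1 n) α).real (avoid M) = (1 - (α : ℝ)) ^ M.card := by
  rw [measureReal_def, setBernoulli_apply']
  have : (fun p : ℕ → Prop => {i | p i}) ⁻¹' avoid M =
      (M : Set ℕ).pi fun _ => {False} := by
    ext p
    simp [avoid, Set.mem_pi]
  rw [this, Measure.infinitePi_pi _ (fun _ _ => MeasurableSet.of_discrete),
    Finset.prod_congr rfl (g := fun _ => ENNReal.ofReal (1 - α))]
  · rw [Finset.prod_const, ENNReal.toReal_pow, ENNReal.toReal_ofReal]
    linarith [α.2.2]
  · intro i hi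
    have hi' := Finset.mem_Icc.1 (hM hi)
    have : i ∈ Set.Icc 1 n := hi'
    simp only [this, Measure.add_apply, Measure.smul_apply]
    rw [Measure.dirac_apply' _ (.of_discrete), Measure.dirac_apply' _ (.of_discrete)]
    simp only [Set.indicator_apply, Set.mem_singleton_iff, eq_iff_iff, true_iff, if_false, smul_zero,
      zero_add, if_true, Pi.one_apply]
    rw [ENNReal.ofReal, ENNReal.smul_def, smul_eq_mul, mul_one, ENNReal.coe_inj]
    ext
    rw [Real.coe_toNNReal _ (by linarith [α.2.2])]
    rfl

/-- The multiples of `d` in `{1, …, n}`. -/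
def multiples (n d : ℕ) : Finset ℕ := {k ∈ Finset.Ioc 0 n | d ∣ k}

theorem card_multiples (n d : ℕ) : (multiples n d).card = n / d :=
  Nat.Ioc_filter_dvd_card_eq_div n d

theorem multiples_subset (n d : ℕ) : multiples n d ⊆ Finset.Icc 1 n := by
  intro k hk
  simp only [multiples, Finset.mem_filter, Finset.mem_Ioc] at hk
  simp only [Finset.mem_Icc]
  omega

theorem card_multiples_union (n d e : ℕ) :
    (multiples n d ∪ multiples n e).card = n / d + n / e - n / d.lcm e := by
  have : multiples n d ∩ multiples n e = multiples n (d.lcm e) := by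
    ext k
    simp only [multiples, Finset.mem_inter, Finset.mem_filter, Nat.lcm_dvd_iff]
    tauto
  have h := Finset.card_union_add_card_inter (multiples n d) (multiples n e)
  rw [this, card_multiples, card_multiples, card_multiples] at h
  omega

theorem div_lcm_le_left (n d e : ℕ) : n / d.lcm e ≤ n / d := by
  rw [← card_multiples, ← card_multiples]
  refine Finset.card_le_card fun k hk => ?_
  simp only [multiples, Finset.mem_filter, Nat.lcm_dvd_iff] at hk ⊢
  tauto

/-- The weight `β^(j₁+j₂-j₃) (1 - β^j₃)`, with `β = 1 - α`: it is the covariance of the indicators of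
the events that a random set avoids two given sets with `j₁` and `j₂` elements, of which `j₃` are
common. -/
def weight (α : ℝ) (j₁ j₂ j₃ : ℕ) : ℝ := (1 - α) ^ (j₁ + j₂ - j₃) * (1 - (1 - α) ^ j₃)

theorem covariance_avoid (n : ℕ) (α : unitInterval) (d e : ℕ) :
    cov[(avoid (multiples n d)).indicator 1, (avoid (multiples n e)).indicator 1;
      setBernoulli (Set.Icc 1 n) α] = weight α (n / d) (n / e) (n / d.lcm e) := by
  have hm := measurableSet_avoid
  rw [covariance_eq_sub (memLp_indicator_avoid _ _) (memLp_indicator_avoid _ _),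
    ← Set.inter_indicator_one, integral_indicator_one ((hm _).inter (hm _)),
    integral_indicator_one (hm _), integral_indicator_one (hm _)]
  have : avoid (multiples n d) ∩ avoid (multiples n e) =
      avoid (multiples n d ∪ multiples n e) := by
    ext s
    simp only [avoid, Set.mem_inter_iff, Set.mem_ofPred_eq, Finset.mem_union]
    grind
  rw [this, setBernoulli_real_avoid α (multiples_subset n d),
    setBernoulli_real_avoid α (multiples_subset n e), setBernoulli_real_avoid α
      (Finset.union_subset (multiples_subset n d) (multiples_subset n e)), card_multiples_union,
    card_multiples, card_multiples, weight, mul_sub, mul_one, ← pow_add, ← pow_add,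
    Nat.sub_add_cancel ((div_lcm_le_left n d e).trans (Nat.le_add_right _ _))]

/-- The random variable is almost surely a constant minus the sum of `φ(d)` over the `d` whose multiples
are avoided. -/
theorem variance_degLcm {Ω : Type*} [MeasurableSpace Ω] {P : Measure Ω} [IsProbabilityMeasure P]
    {n : ℕ} {α : unitInterval} {𝒜 : Ω → Set ℕ} (h : IsModel n α 𝒜 P) :
    Var[fun ω => (degLcm (𝒜 ω) : ℝ); P] = ∑ d ∈ Finset.Icc 2 n, ∑ e ∈ Finset.Icc 2 n,
      (d.totient : ℝ) * e.totient * weight α (n / d) (n / e) (n / d.lcm e) := by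
  classical
  set F : Set ℕ → ℝ := fun s =>
    ∑ d ∈ Finset.Icc 2 n, (d.totient : ℝ) * (avoid (multiples n d)).indicator 1 s
  have hF : Measurable F := Finset.measurable_sum _ fun d _ =>
    (measurable_one.indicator (measurableSet_avoid _)).const_mul _
  have hae : (fun ω => (degLcm (𝒜 ω) : ℝ)) =ᵐ[P]
      fun ω => (∑ d ∈ Finset.Icc 2 n, (d.totient : ℝ)) - F (𝒜 ω) := by
    have hs : ∀ᵐ ω ∂P, 𝒜 ω ⊆ Set.Icc 1 n := IsSetBernoulli.ae_subset h
    filter_upwards [hs] with ω hω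
    rw [degLcm_eq hω, Finset.sum_filter, Nat.cast_sum, ← Finset.sum_sub_distrib]
    refine Finset.sum_congr rfl fun d _ => ?_
    by_cases hd : ∃ k ∈ 𝒜 ω, d ∣ k
    · have : 𝒜 ω ∉ avoid (multiples n d) := by
        obtain ⟨k, hk, hdk⟩ := hd
        have := hω hk
        simp only [avoid, Set.mem_ofPred_eq, multiples, Finset.mem_filter, Finset.mem_Ioc, not_forall,
          not_not]
        exact ⟨k, ⟨⟨this.1, this.2⟩, hdk⟩, hk⟩
      simp [this, hd]
    · have : 𝒜 ω ∈ avoid (multiples n d) := by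
        intro i hi hi'
        exact hd ⟨i, hi', (Finset.mem_filter.1 hi).2⟩
      simp [this, hd]
  have hlaw : HasLaw 𝒜 (setBernoulli (Set.Icc 1 n) α) P := h
  have hFm : AEStronglyMeasurable (fun ω => F (𝒜 ω)) P :=
    (hF.comp_aemeasurable hlaw.aemeasurable).aestronglyMeasurable
  rw [variance_congr hae, variance_const_sub hFm]
  have : Var[fun ω => F (𝒜 ω); P] = Var[F; setBernoulli (Set.Icc 1 n) α] := by
    rw [← hlaw.map_eq, variance_map hF.aemeasurable hlaw.aemeasurable]
    rfl
  rw [this, variance_fun_sum' fun d _ => (memLp_indicator_avoid _ _).const_mul _]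
  refine Finset.sum_congr rfl fun d _ => Finset.sum_congr rfl fun e _ => ?_
  rw [covariance_const_mul_left, covariance_const_mul_right, covariance_avoid]
  ring

/-! ### The constants `C₁(a₁, a₂)` -/

open Filter Topology

/-- Bounding the least common multiple from below by the geometric mean, the terms are dominated by a
multiple of `(d₁ d₂)^(-3/2)`. -/
theorem summable_C₁Term {a₁ a₂ : ℕ} (ha₁ : 0 < a₁) (ha₂ : 0 < a₂) : Summable (C₁Term a₁ a₂) := by
  have hs : Summable fun d : ℕ => 1 / (d : ℝ) ^ (3 / 2 : ℝ) :=
    Real.summable_one_div_nat_rpow.2 (by norm_num)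
  have hs2 := (hs.mul_of_nonneg hs (fun _ => by positivity) (fun _ => by positivity)).mul_left
    (√(a₁ * a₂ : ℝ))
  refine Summable.of_norm_bounded hs2 fun d => ?_
  obtain ⟨d₁, d₂⟩ := d
  rcases Nat.eq_zero_or_pos d₁ with rfl | h₁
  · simp [C₁Term]
  rcases Nat.eq_zero_or_pos d₂ with rfl | h₂
  · simp [C₁Term]
  have hμ (d : ℕ) : |((ArithmeticFunction.moebius d : ℤ) : ℝ)| ≤ 1 := by
    exact_mod_cast ArithmeticFunction.abs_moebius_le_one
  have hquot (a d : ℕ) (ha : 0 < a) (hd : 0 < d) :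
      0 < d / a.gcd d ∧ (d : ℝ) ≤ a * (d / a.gcd d : ℕ) := by
    have h1 : d / a.gcd d * a.gcd d = d := Nat.div_mul_cancel (Nat.gcd_dvd_right a d)
    have h2 : a.gcd d ≤ a := Nat.gcd_le_left d ha
    refine ⟨Nat.pos_of_ne_zero fun h => by simp [h] at h1; omega, ?_⟩
    have : d ≤ a * (d / a.gcd d) := by
      calc d = d / a.gcd d * a.gcd d := h1.symm
        _ ≤ d / a.gcd d * a := by gcongr
        _ = _ := mul_comm _ _
    exact_mod_cast this
  obtain ⟨hu, hu'⟩ := hquot a₁ d₁ ha₁ h₁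
  obtain ⟨hv, hv'⟩ := hquot a₂ d₂ ha₂ h₂
  simp only [C₁Term]
  set u := d₁ / a₁.gcd d₁
  set v := d₂ / a₂.gcd d₂
  have hl1 : u ≤ u.lcm v := Nat.le_of_dvd (Nat.lcm_pos hu hv) (Nat.dvd_lcm_left u v)
  have hl2 : v ≤ u.lcm v := Nat.le_of_dvd (Nat.lcm_pos hu hv) (Nat.dvd_lcm_right u v)
  set l := u.lcm v
  have hl0 : 0 < l := by omega
  -- the least common multiple of `u` and `v` is at least their geometric mean
  have hdl : √(d₁ : ℝ) * √(d₂ : ℝ) ≤ √(a₁ * a₂ : ℝ) * l := by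
    rw [← Real.sqrt_mul (by positivity), ← Real.sqrt_sq (show (0 : ℝ) ≤ l by positivity),
      ← Real.sqrt_mul (by positivity)]
    refine Real.sqrt_le_sqrt ?_
    calc (d₁ : ℝ) * d₂ ≤ (a₁ * u) * (a₂ * v) := by gcongr
      _ ≤ (a₁ * l) * (a₂ * l) := by gcongr
      _ = _ := by ring
  have hpow (d : ℕ) : (d : ℝ) ^ (3 / 2 : ℝ) = d * √(d : ℝ) := by
    rw [show (3 / 2 : ℝ) = 1 + 1 / 2 by norm_num,
      Real.rpow_add_of_nonneg (by positivity) (by norm_num) (by norm_num), Real.rpow_one,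
      Real.sqrt_eq_rpow]
  rw [Real.norm_eq_abs, abs_div, abs_mul, abs_of_nonneg (show (0 : ℝ) ≤ d₁ * d₂ * l by positivity),
    hpow, hpow, div_mul_div_comm, one_mul, mul_one_div,
    div_le_div_iff₀ (by positivity) (by positivity)]
  calc _ ≤ (1 * 1) * ((d₁ * √(d₁ : ℝ)) * (d₂ * √(d₂ : ℝ))) := by gcongr <;> exact hμ _
    _ = (√(d₁ : ℝ) * √(d₂ : ℝ)) * (d₁ * d₂) := by ring
    _ ≤ (√(a₁ * a₂ : ℝ) * l) * (d₁ * d₂) := by gcongr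
    _ = _ := by ring

theorem totient_eq_sum_moebius {k : ℕ} (hk : 0 < k) :
    (k.totient : ℝ) =
      k * ∑ d ∈ k.divisors, ((ArithmeticFunction.moebius d : ℤ) : ℝ) / (d : ℝ) := by
  have h := (ArithmeticFunction.sum_eq_iff_sum_mul_moebius_eq (R := ℝ)
    (f := fun k => (k.totient : ℝ)) (g := fun k => (k : ℝ))).1
    (fun n _ => by exact_mod_cast Nat.sum_totient n) k hk
  rw [← h, Nat.sum_divisorsAntidiagonal
    (f := fun x y => ((ArithmeticFunction.moebius x : ℤ) : ℝ) * (y : ℝ)), Finset.mul_sum]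
  refine Finset.sum_congr rfl fun d hd => ?_
  rw [Nat.cast_div (Nat.dvd_of_mem_divisors hd) (by
    have := Nat.pos_of_mem_divisors hd
    positivity)]
  ring

theorem dvd_mul_iff_div_gcd_dvd {a d m : ℕ} (hd : 0 < d) : d ∣ a * m ↔ d / a.gcd d ∣ m := by
  rw [Nat.div_dvd_iff_dvd_mul (Nat.gcd_dvd_right a d) (Nat.gcd_pos_of_pos_right a hd), Nat.gcd_comm,
    Nat.dvd_gcd_mul_iff_dvd_mul]

/-- The sum of `φ(a₁ m) φ(a₂ m)` over `1 ≤ m ≤ N`. -/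
def totientSum (a₁ a₂ N : ℕ) : ℝ :=
  ∑ m ∈ Finset.Icc 1 N, ((a₁ * m).totient : ℝ) * ((a₂ * m).totient : ℝ)

/-- The sum of the squares of the multiples of `l` up to `N`. -/
def sqSum (l N : ℕ) : ℝ := ∑ m ∈ Finset.Icc 1 N with l ∣ m, (m : ℝ) ^ 2

theorem sqSum_eq {l : ℕ} (hl : 0 < l) (N : ℕ) :
    sqSum l N = (l : ℝ) ^ 2 * ((N / l : ℕ) * ((N / l : ℕ) + 1) * (2 * (N / l : ℕ) + 1) / 6) := by
  have h1 : sqSum l N = ∑ k ∈ Finset.Icc 1 (N / l), ((l * k : ℕ) : ℝ) ^ 2 := by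
    symm
    refine Finset.sum_bij' (fun k _ => l * k) (fun m _ => m / l) ?_ ?_ ?_ ?_ ?_
    · intro k hk
      simp only [Finset.mem_Icc, Finset.mem_filter] at hk ⊢
      have := (Nat.le_div_iff_mul_le hl).1 hk.2
      refine ⟨⟨Nat.mul_pos hl hk.1, by linarith⟩, dvd_mul_right _ _⟩
    · intro m hm
      simp only [Finset.mem_Icc, Finset.mem_filter] at hm ⊢
      exact ⟨Nat.div_pos (Nat.le_of_dvd hm.1.1 hm.2) hl, Nat.div_le_div_right hm.1.2⟩
    · intro k _
      exact Nat.mul_div_cancel_left k hl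
    · intro m hm
      exact Nat.mul_div_cancel' (Finset.mem_filter.1 hm).2
    · intro k _
      rfl
  have h2 (M : ℕ) : ∑ k ∈ Finset.Icc 1 M, (k : ℝ) ^ 2 = M * (M + 1) * (2 * M + 1) / 6 := by
    induction M with
    | zero => simp
    | succ M ih =>
      rw [Finset.sum_Icc_succ_top (by omega), ih]
      push_cast
      ring
  rw [h1, ← h2, Finset.mul_sum]
  refine Finset.sum_congr rfl fun k _ => ?_
  push_cast
  ring

theorem sqSum_nonneg (l N : ℕ) : 0 ≤ sqSum l N := Finset.sum_nonneg fun _ _ => by positivity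

theorem sqSum_le {l : ℕ} (N : ℕ) : sqSum l N ≤ (N : ℝ) ^ 3 / l := by
  have h : sqSum l N ≤ (Finset.card {m ∈ Finset.Ioc 0 N | l ∣ m}) • (N : ℝ) ^ 2 := by
    refine Finset.sum_le_card_nsmul _ _ _ fun m hm => ?_
    simp only [Finset.mem_Icc, Finset.mem_filter] at hm
    have : (m : ℝ) ≤ N := by exact_mod_cast hm.1.2
    gcongr
  rw [Nat.Ioc_filter_dvd_card_eq_div, nsmul_eq_mul] at h
  calc _ ≤ _ := h
    _ ≤ (N : ℝ) / l * N ^ 2 := by gcongr; exact Nat.cast_div_le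
    _ = _ := by ring

theorem tendsto_sqSum {l : ℕ} (hl : 0 < l) :
    Tendsto (fun N : ℕ => sqSum l N / (N : ℝ) ^ 3) atTop (𝓝 (1 / (3 * l))) := by
  have hl' : (l : ℝ) ≠ 0 := by positivity
  have h1 : Tendsto (fun N : ℕ => ((N / l : ℕ) : ℝ) / N) atTop (𝓝 (1 / l)) := by
    have h := (tendsto_nat_floor_mul_div_atTop (R := ℝ) (a := 1 / l) (by positivity)).comp
      tendsto_natCast_atTop_atTop
    refine h.congr fun N => ?_
    simp only [Function.comp_apply]
    rw [one_div_mul_eq_div, Nat.floor_div_eq_div]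
  have h2 : Tendsto (fun N : ℕ => (1 : ℝ) / N) atTop (𝓝 0) := tendsto_one_div_atTop_nhds_zero_nat
  have h3 := ((h1.mul (h1.add h2)).mul ((h1.const_mul 2).add h2)).const_mul ((l : ℝ) ^ 2 / 6)
  have e : (l : ℝ) ^ 2 / 6 * (1 / l * (1 / l + 0) * (2 * (1 / l) + 0)) = 1 / (3 * l) := by
    field_simp
    norm_num
  rw [e] at h3
  refine h3.congr' ?_
  filter_upwards [eventually_gt_atTop 0] with N hN
  rw [sqSum_eq hl]
  have : (N : ℝ) ≠ 0 := by positivity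
  field_simp

theorem totientSum_eq_tsum {a₁ a₂ : ℕ} (ha₁ : 0 < a₁) (ha₂ : 0 < a₂) (N : ℕ) :
    totientSum a₁ a₂ N = a₁ * a₂ * ∑' d : ℕ × ℕ,
      ((ArithmeticFunction.moebius d.1 : ℤ) : ℝ) * ((ArithmeticFunction.moebius d.2 : ℤ) : ℝ) /
        ((d.1 : ℝ) * d.2) * sqSum ((d.1 / a₁.gcd d.1).lcm (d.2 / a₂.gcd d.2)) N := by
  set c : ℕ × ℕ → ℝ := fun d =>
    ((ArithmeticFunction.moebius d.1 : ℤ) : ℝ) * ((ArithmeticFunction.moebius d.2 : ℤ) : ℝ) /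
        ((d.1 : ℝ) * d.2) with hc
  set l : ℕ × ℕ → ℕ := fun d => (d.1 / a₁.gcd d.1).lcm (d.2 / a₂.gcd d.2) with hl
  have hone (m : ℕ) (hm : m ∈ Finset.Icc 1 N) :
      HasSum (fun d => c d * if l d ∣ m then (m : ℝ) ^ 2 else 0)
        (((a₁ * m).totient : ℝ) * (a₂ * m).totient / (a₁ * a₂)) := by
    have hm0 : 0 < m := (Finset.mem_Icc.1 hm).1
    have e : ((a₁ * m).totient : ℝ) * (a₂ * m).totient / (a₁ * a₂) =
        ∑ d ∈ (a₁ * m).divisors ×ˢ (a₂ * m).divisors,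
          c d * if l d ∣ m then (m : ℝ) ^ 2 else 0 := by
      rw [totient_eq_sum_moebius (Nat.mul_pos ha₁ hm0), totient_eq_sum_moebius (Nat.mul_pos ha₂ hm0),
        mul_mul_mul_comm, Finset.sum_mul_sum, ← Finset.sum_product', mul_div_right_comm,
        Finset.mul_sum]
      refine Finset.sum_congr rfl fun d hd => ?_
      have hd' := Finset.mem_product.1 hd
      have h1 := Nat.pos_of_mem_divisors hd'.1
      have h2 := Nat.pos_of_mem_divisors hd'.2
      rw [if_pos (Nat.lcm_dvd ((dvd_mul_iff_div_gcd_dvd h1).1 (Nat.dvd_of_mem_divisors hd'.1))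
        ((dvd_mul_iff_div_gcd_dvd h2).1 (Nat.dvd_of_mem_divisors hd'.2)))]
      simp only [hc]
      push_cast
      field_simp
    rw [e]
    refine hasSum_sum_of_ne_finset_zero fun d hd => ?_
    rcases Nat.eq_zero_or_pos d.1 with h1 | h1
    · simp [hc, h1]
    rcases Nat.eq_zero_or_pos d.2 with h2 | h2
    · simp [hc, h2]
    rw [if_neg, mul_zero]
    intro h
    rw [hl, Nat.lcm_dvd_iff, ← dvd_mul_iff_div_gcd_dvd h1, ← dvd_mul_iff_div_gcd_dvd h2] at h
    exact hd (Finset.mem_product.2 ⟨Nat.mem_divisors.2 ⟨h.1, (Nat.mul_pos ha₁ hm0).ne'⟩,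
      Nat.mem_divisors.2 ⟨h.2, (Nat.mul_pos ha₂ hm0).ne'⟩⟩)
  have h := (hasSum_sum hone).tsum_eq
  simp only [← Finset.mul_sum, ← Finset.sum_filter, ← Finset.sum_div] at h
  have : (a₁ : ℝ) * a₂ ≠ 0 := by positivity
  calc totientSum a₁ a₂ N = a₁ * a₂ * (totientSum a₁ a₂ N / (a₁ * a₂)) := by field_simp
    _ = _ := by rw [totientSum, ← h]; rfl

/-- The sum of `φ(a₁ m) φ(a₂ m)` over `m ≤ N` is asymptotic to `C₁(a₁, a₂) N³`: expand both totients
by Möbius inversion, and apply dominated convergence to the sum over the pair of divisors. -/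
theorem tendsto_totientSum {a₁ a₂ : ℕ} (ha₁ : 0 < a₁) (ha₂ : 0 < a₂) :
    Tendsto (fun N : ℕ => totientSum a₁ a₂ N / (N : ℝ) ^ 3) atTop (𝓝 (C₁ a₁ a₂)) := by
  have hs := (summable_C₁Term ha₁ ha₂).norm
  have hcongr (d : ℕ × ℕ) (x : ℝ) :
      C₁Term a₁ a₂ d * (((d.1 / a₁.gcd d.1).lcm (d.2 / a₂.gcd d.2) : ℕ) * x) =
      ((ArithmeticFunction.moebius d.1 : ℤ) : ℝ) * ((ArithmeticFunction.moebius d.2 : ℤ) : ℝ) /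
        ((d.1 : ℝ) * d.2) * x := by
    rcases Nat.eq_zero_or_pos d.1 with h1 | h1
    · simp [C₁Term, h1]
    rcases Nat.eq_zero_or_pos d.2 with h2 | h2
    · simp [C₁Term, h2]
    have hq (a d : ℕ) (hd : 0 < d) : 0 < d / a.gcd d :=
      Nat.div_pos (Nat.gcd_le_right a hd) (Nat.gcd_pos_of_pos_right a hd)
    have hl : 0 < (d.1 / a₁.gcd d.1).lcm (d.2 / a₂.gcd d.2) := Nat.lcm_pos (hq _ _ h1) (hq _ _ h2)
    rw [C₁Term]
    set l := (d.1 / a₁.gcd d.1).lcm (d.2 / a₂.gcd d.2)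
    field_simp
  have hlim := tendsto_tsum_of_dominated_convergence (𝓕 := atTop)
    (f := fun (N : ℕ) (d : ℕ × ℕ) => C₁Term a₁ a₂ d *
      (((d.1 / a₁.gcd d.1).lcm (d.2 / a₂.gcd d.2) : ℕ) *
        (sqSum ((d.1 / a₁.gcd d.1).lcm (d.2 / a₂.gcd d.2)) N / (N : ℝ) ^ 3)))
    (g := fun d => C₁Term a₁ a₂ d * (1 / 3)) hs ?_ ?_
  · have h2 := hlim.const_mul ((a₁ : ℝ) * a₂)
    rw [tsum_mul_right, show (a₁ : ℝ) * a₂ * ((∑' d, C₁Term a₁ a₂ d) * (1 / 3)) = C₁ a₁ a₂ by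
      rw [C₁]; ring] at h2
    refine h2.congr fun N => ?_
    rw [totientSum_eq_tsum ha₁ ha₂, mul_div_assoc, ← tsum_div_const]
    congr 1
    refine tsum_congr fun d => ?_
    rw [hcongr]
    ring
  · intro d
    rcases Nat.eq_zero_or_pos ((d.1 / a₁.gcd d.1).lcm (d.2 / a₂.gcd d.2)) with hl | hl
    · simp [C₁Term, hl]
    refine Tendsto.const_mul _ ?_
    have := (tendsto_sqSum hl).const_mul
      (((d.1 / a₁.gcd d.1).lcm (d.2 / a₂.gcd d.2) : ℕ) : ℝ)
    convert this using 2
    field_simp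
  · refine Eventually.of_forall fun N d => ?_
    rw [norm_mul]
    refine mul_le_of_le_one_right (norm_nonneg _) ?_
    rw [Real.norm_of_nonneg (mul_nonneg (Nat.cast_nonneg _)
      (div_nonneg (sqSum_nonneg _ _) (by positivity)))]
    set l := (d.1 / a₁.gcd d.1).lcm (d.2 / a₂.gcd d.2)
    calc (l : ℝ) * (sqSum l N / N ^ 3) ≤ l * ((N : ℝ) ^ 3 / l / N ^ 3) := by
          gcongr
          exact sqSum_le N
      _ = (l / l) * ((N : ℝ) ^ 3 / N ^ 3) := by ring
      _ ≤ 1 * 1 := by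
          gcongr <;> exact div_self_le_one _
      _ = 1 := one_mul 1

/-! ### Pairs of integers with a small least common multiple -/

/-- The pairs of positive integers with least common multiple at most `n`. -/
def pairs (n : ℕ) : Finset (ℕ × ℕ) :=
  {p ∈ Finset.Icc 1 n ×ˢ Finset.Icc 1 n | p.1.lcm p.2 ≤ n}

/-- The index `(a₁, a₂, j₁, j₂, j₃)` of a pair `(a₁ m, a₂ m)` with `m = gcd(a₁ m, a₂ m)`, where `j₁`,
`j₂`, `j₃` count the multiples up to `n` of the first number, of the second one and of both. -/
def pairIndex (n : ℕ) (p : ℕ × ℕ) : Index where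
  a₁ := p.1 / p.1.gcd p.2
  a₂ := p.2 / p.1.gcd p.2
  j₁ := n / p.1
  j₂ := n / p.2
  j₃ := n / p.1.lcm p.2

/-- The product `φ(d) φ(e)` for a pair `(d, e)`. -/
def totientProd (p : ℕ × ℕ) : ℝ := (p.1.totient : ℝ) * p.2.totient

/-- The sum of `φ(d) φ(e)` over the pairs `(d, e)` with a given index. -/
noncomputable def fiberSum (n : ℕ) (t : Index) : ℝ :=
  open scoped Classical in ∑ p ∈ pairs n with pairIndex n p = t, totientProd p

/-- The weight attached to an index; it depends on `j₁`, `j₂`, `j₃` only. -/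
def Index.weight (α : ℝ) (t : Index) : ℝ := QLcm.weight α t.j₁ t.j₂ t.j₃

/-- The part of an index by which the sum is dominated. -/
def Index.core (t : Index) : ℕ × ℕ × ℕ := (t.a₁, t.a₂, t.j₃)

/-- The dominating function `1 / (a₁ a₂ j₃)²`. -/
noncomputable def coreBound (u : ℕ × ℕ × ℕ) : ℝ :=
  1 / (u.1 : ℝ) ^ 2 * (1 / (u.2.1 : ℝ) ^ 2 * (1 / (u.2.2 : ℝ) ^ 2))

theorem mem_pairs {n : ℕ} {p : ℕ × ℕ} :
    p ∈ pairs n ↔ 0 < p.1 ∧ 0 < p.2 ∧ p.1.lcm p.2 ≤ n := by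
  simp only [pairs, Finset.mem_filter, Finset.mem_product, Finset.mem_Icc]
  constructor
  · rintro ⟨⟨h1, h2⟩, h3⟩
    exact ⟨h1.1, h2.1, h3⟩
  · rintro ⟨h1, h2, h3⟩
    have h := Nat.lcm_pos h1 h2
    exact ⟨⟨⟨h1, (Nat.le_of_dvd h (Nat.dvd_lcm_left _ _)).trans h3⟩, h2,
      (Nat.le_of_dvd h (Nat.dvd_lcm_right _ _)).trans h3⟩, h3⟩

theorem totientProd_nonneg (p : ℕ × ℕ) : 0 ≤ totientProd p := by
  unfold totientProd
  positivity

theorem lcm_mul_of_coprime {a b m : ℕ} (h : a.Coprime b) : (a * m).lcm (b * m) = a * b * m := by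
  rw [Nat.lcm_mul_right, h.lcm_eq_mul]

theorem pairIndex_mul {n a b m : ℕ} (h : a.Coprime b) (hm : 0 < m) :
    pairIndex n (a * m, b * m) = ⟨a, b, n / (a * m), n / (b * m), n / (a * b * m)⟩ := by
  have hg : (a * m).gcd (b * m) = m := by rw [Nat.gcd_mul_right, h.gcd_eq_one, one_mul]
  simp only [pairIndex, lcm_mul_of_coprime h, hg, Nat.mul_div_cancel _ hm]

theorem eq_mul_of_mem_pairs {n : ℕ} {p : ℕ × ℕ} (hp : p ∈ pairs n) :
    0 < p.1.gcd p.2 ∧ 0 < (pairIndex n p).a₁ ∧ 0 < (pairIndex n p).a₂ ∧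
      (pairIndex n p).a₁.Coprime (pairIndex n p).a₂ ∧
      p = ((pairIndex n p).a₁ * p.1.gcd p.2, (pairIndex n p).a₂ * p.1.gcd p.2) := by
  obtain ⟨h1, h2, -⟩ := mem_pairs.1 hp
  have hg : 0 < p.1.gcd p.2 := Nat.gcd_pos_of_pos_left _ h1
  refine ⟨hg, Nat.div_gcd_pos_of_pos_left _ h1, Nat.div_gcd_pos_of_pos_right _ h2,
    Nat.coprime_div_gcd_div_gcd hg, Prod.ext ?_ ?_⟩
  · exact (Nat.div_mul_cancel (Nat.gcd_dvd_left _ _)).symm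
  · exact (Nat.div_mul_cancel (Nat.gcd_dvd_right _ _)).symm

/-- The condition `ρ₁ n < m ≤ ρ₂ n` says that `(a₁ m, a₂ m)` has the given `j₁`, `j₂`, `j₃`. -/
theorem mem_Ioc_floor_iff {t : Index} (h₁ : 0 < t.a₁) (h₂ : 0 < t.a₂) (k₁ : 0 < t.j₁)
    (k₂ : 0 < t.j₂) (k₃ : 0 < t.j₃) {n m : ℕ} (hm : 0 < m) :
    m ∈ Finset.Ioc ⌊ρ₁ t * n⌋₊ ⌊ρ₂ t * n⌋₊ ↔
      n / (t.a₁ * m) = t.j₁ ∧ n / (t.a₂ * m) = t.j₂ ∧ n / (t.a₁ * t.a₂ * m) = t.j₃ := by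
  have key (a j : ℕ) (ha : 0 < a) (hj : 0 < j) :
      ((1 / ((a : ℝ) * (j + 1))) * n < m ∧ (m : ℝ) ≤ 1 / ((a : ℝ) * j) * n) ↔ n / (a * m) = j := by
    rw [Nat.div_eq_iff (Nat.mul_pos ha hm), one_div_mul_eq_div, one_div_mul_eq_div,
      div_lt_iff₀ (by positivity), le_div_iff₀ (by positivity)]
    norm_cast
    have : 0 < a * m := Nat.mul_pos ha hm
    rw [and_comm, show m * (a * (j + 1)) = j * (a * m) + a * m by ring,
      show m * (a * j) = j * (a * m) by ring]
    omega
  have p₁ : 0 ≤ ρ₁ t := le_max_of_le_left (by positivity)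
  have p₂ : 0 ≤ ρ₂ t := le_min (by positivity) (le_min (by positivity) (by positivity))
  have n0 : (0 : ℝ) ≤ n := n.cast_nonneg
  rw [Finset.mem_Ioc, Nat.floor_lt (by positivity), Nat.le_floor_iff (by positivity), ← key _ _ h₁ k₁,
    ← key _ _ h₂ k₂, ← key _ _ (Nat.mul_pos h₁ h₂) k₃, ρ₁, ρ₂, max_mul_of_nonneg _ _ n0,
    max_mul_of_nonneg _ _ n0, min_mul_of_nonneg _ _ n0, min_mul_of_nonneg _ _ n0, max_lt_iff,
    max_lt_iff, le_min_iff, le_min_iff]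
  push_cast
  tauto

/-- The interval `(ρ₁ n, ρ₂ n]` contains the greatest common divisor of the pair, so `ρ₁ < ρ₂`. -/
theorem pairIndex_mem {n : ℕ} {p : ℕ × ℕ} (hp : p ∈ pairs n) : pairIndex n p ∈ indexSet := by
  obtain ⟨hg, h₁, h₂, hc, -⟩ := eq_mul_of_mem_pairs hp
  obtain ⟨q₁, q₂, q₃⟩ := mem_pairs.1 hp
  have k₃ : 0 < (pairIndex n p).j₃ := Nat.div_pos q₃ (Nat.lcm_pos q₁ q₂)
  have k₁ : 0 < (pairIndex n p).j₁ := k₃.trans_le (div_lcm_le_left n p.1 p.2)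
  have k₂ : 0 < (pairIndex n p).j₂ := by
    refine k₃.trans_le ?_
    simp only [pairIndex]
    rw [Nat.lcm_comm]
    exact div_lcm_le_left n p.2 p.1
  refine ⟨h₁, h₂, k₁, k₂, k₃, hc, ?_⟩
  have hm := (mem_Ioc_floor_iff h₁ h₂ k₁ k₂ k₃ hg (n := n)).2 (by
    have e1 : (pairIndex n p).a₁ * p.1.gcd p.2 = p.1 := Nat.div_mul_cancel (Nat.gcd_dvd_left _ _)
    have e2 : (pairIndex n p).a₂ * p.1.gcd p.2 = p.2 := Nat.div_mul_cancel (Nat.gcd_dvd_right _ _)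
    rw [← lcm_mul_of_coprime hc, e1, e2]
    exact ⟨rfl, rfl, rfl⟩)
  rw [Finset.mem_Ioc] at hm
  by_contra! h
  have := Nat.floor_mono (mul_le_mul_of_nonneg_right h n.cast_nonneg)
  omega

open scoped Classical in
theorem fiberSum_eq {t : Index} (ht : t ∈ indexSet) (n : ℕ) :
    fiberSum n t = totientSum t.a₁ t.a₂ ⌊ρ₂ t * n⌋₊ - totientSum t.a₁ t.a₂ ⌊ρ₁ t * n⌋₊ := by
  obtain ⟨h₁, h₂, k₁, k₂, k₃, hc, hρ⟩ := ht
  have hle : ⌊ρ₁ t * n⌋₊ ≤ ⌊ρ₂ t * n⌋₊ :=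
    Nat.floor_mono (mul_le_mul_of_nonneg_right hρ.le n.cast_nonneg)
  have hI (N : ℕ) : Finset.Icc 1 N = Finset.Ioc 0 N := by ext; simp; omega
  rw [eq_sub_iff_add_eq', totientSum, totientSum, hI, hI,
    ← Finset.sum_Ioc_consecutive _ (Nat.zero_le _) hle, add_right_inj]
  symm
  refine Finset.sum_bij (fun m _ => (t.a₁ * m, t.a₂ * m)) ?_ ?_ ?_ ?_
  · intro m hm
    have hm0 : 0 < m := (Nat.zero_le _).trans_lt (Finset.mem_Ioc.1 hm).1
    obtain ⟨e₁, e₂, e₃⟩ := (mem_Ioc_floor_iff h₁ h₂ k₁ k₂ k₃ hm0).1 hm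
    rw [Finset.mem_filter, mem_pairs, pairIndex_mul hc hm0, lcm_mul_of_coprime hc]
    refine ⟨⟨Nat.mul_pos h₁ hm0, Nat.mul_pos h₂ hm0, ?_⟩, Index.ext rfl rfl e₁ e₂ e₃⟩
    by_contra! h
    rw [Nat.div_eq_of_lt h] at e₃
    omega
  · intro m _ m' _ h
    exact Nat.eq_of_mul_eq_mul_left h₁ (Prod.ext_iff.1 h).1
  · intro p hp
    rw [Finset.mem_filter] at hp
    obtain ⟨hp, rfl⟩ := hp
    obtain ⟨hg, -, -, -, e⟩ := eq_mul_of_mem_pairs hp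
    refine ⟨p.1.gcd p.2, (mem_Ioc_floor_iff h₁ h₂ k₁ k₂ k₃ hg).2 ?_, e.symm⟩
    have e1 : (pairIndex n p).a₁ * p.1.gcd p.2 = p.1 := Nat.div_mul_cancel (Nat.gcd_dvd_left _ _)
    have e2 : (pairIndex n p).a₂ * p.1.gcd p.2 = p.2 := Nat.div_mul_cancel (Nat.gcd_dvd_right _ _)
    rw [← lcm_mul_of_coprime hc, e1, e2]
    exact ⟨rfl, rfl, rfl⟩
  · intro m _
    rfl

theorem fiberSum_nonneg (n : ℕ) (t : Index) : 0 ≤ fiberSum n t :=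
  Finset.sum_nonneg fun p _ => totientProd_nonneg p

theorem tendsto_fiberSum {t : Index} (ht : t ∈ indexSet) :
    Tendsto (fun n : ℕ => fiberSum n t / (n : ℝ) ^ 3) atTop
      (𝓝 (C₁ t.a₁ t.a₂ * (ρ₂ t ^ 3 - ρ₁ t ^ 3))) := by
  have ht' := ht
  obtain ⟨h₁, h₂, k₁, k₂, k₃, hc, hρ⟩ := ht'
  have p₁ : 0 < ρ₁ t := lt_max_of_lt_left (by positivity)
  have key (ρ : ℝ) (hρ : 0 < ρ) :
      Tendsto (fun n : ℕ => totientSum t.a₁ t.a₂ ⌊ρ * n⌋₊ / (n : ℝ) ^ 3) atTop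
        (𝓝 (C₁ t.a₁ t.a₂ * ρ ^ 3)) := by
    have hf : Tendsto (fun n : ℕ => ⌊ρ * (n : ℝ)⌋₊) atTop atTop :=
      tendsto_nat_floor_atTop.comp (tendsto_natCast_atTop_atTop.const_mul_atTop hρ)
    have hq := (tendsto_nat_floor_mul_div_atTop (R := ℝ) hρ.le).comp tendsto_natCast_atTop_atTop
    refine (((tendsto_totientSum h₁ h₂).comp hf).mul (hq.pow 3)).congr' ?_
    filter_upwards [hf.eventually_gt_atTop 0] with n hn
    have : ((⌊ρ * (n : ℝ)⌋₊ : ℕ) : ℝ) ≠ 0 := by positivity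
    simp only [Function.comp_apply]
    field_simp
  rw [mul_sub]
  refine ((key _ (p₁.trans hρ)).sub (key _ p₁)).congr fun n => ?_
  rw [fiberSum_eq ht, sub_div]

/-! ### Domination -/

theorem weight_nonneg {α : ℝ} (h0 : 0 ≤ α) (h1 : α ≤ 1) (j₁ j₂ j₃ : ℕ) : 0 ≤ weight α j₁ j₂ j₃ :=
  mul_nonneg (pow_nonneg (by linarith) _)
    (sub_nonneg.2 (pow_le_one₀ (by linarith) (by linarith)))

theorem weight_le_one {α : ℝ} (h0 : 0 ≤ α) (h1 : α ≤ 1) (j₁ j₂ j₃ : ℕ) :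
    weight α j₁ j₂ j₃ ≤ 1 :=
  mul_le_one₀ (pow_le_one₀ (by linarith) (by linarith))
    (sub_nonneg.2 (pow_le_one₀ (by linarith) (by linarith)))
    (sub_le_self _ (pow_nonneg (by linarith) _))

/-- Bernoulli's inequality. -/
theorem weight_le {α : ℝ} (h0 : 0 ≤ α) (h1 : α ≤ 1) (j₁ j₂ j₃ : ℕ) :
    weight α j₁ j₂ j₃ ≤ α * j₃ := by
  have hb := one_add_mul_le_pow (show (-2 : ℝ) ≤ -α by linarith) j₃
  have e : (1 : ℝ) + -α = 1 - α := by ring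
  rw [e] at hb
  have hnn : 0 ≤ 1 - (1 - α) ^ j₃ := sub_nonneg.2 (pow_le_one₀ (by linarith) (by linarith))
  calc weight α j₁ j₂ j₃ ≤ 1 * (1 - (1 - α) ^ j₃) :=
        mul_le_mul_of_nonneg_right (pow_le_one₀ (by linarith) (by linarith)) hnn
    _ ≤ α * j₃ := by linarith

theorem coreBound_nonneg (u : ℕ × ℕ × ℕ) : 0 ≤ coreBound u := by
  unfold coreBound
  positivity

theorem summable_coreBound : Summable coreBound := by
  have hs : Summable fun d : ℕ => 1 / (d : ℝ) ^ 2 := Real.summable_one_div_nat_pow.2 one_lt_two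
  exact hs.mul_of_nonneg (hs.mul_of_nonneg hs (fun _ => by positivity) (fun _ => by positivity))
    (fun _ => by positivity) (fun _ => mul_nonneg (by positivity) (by positivity))

/-- The pairs with given `a₁`, `a₂`, `j₃` are among the `(a₁ m, a₂ m)` with `m ≤ n / (a₁ a₂ j₃)`. -/
theorem sum_core_le {n : ℕ} {α : ℝ} (h0 : 0 ≤ α) (h1 : α ≤ 1) {Q : Finset (ℕ × ℕ)}
    (hQ : Q ⊆ pairs n) (u : ℕ × ℕ × ℕ) (hu : ∀ p ∈ Q, (pairIndex n p).core = u) :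
    ∑ p ∈ Q, totientProd p * (pairIndex n p).weight α ≤ α * (n : ℝ) ^ 3 * coreBound u := by
  rcases Q.eq_empty_or_nonempty with rfl | ⟨q, hq⟩
  · simpa using mul_nonneg (by positivity) (coreBound_nonneg u)
  obtain ⟨h₁, h₂, -, -, k₃, -, -⟩ := pairIndex_mem (hQ hq)
  have e := hu q hq
  obtain ⟨a, b, j⟩ := u
  simp only [Index.core, Prod.mk.injEq] at e
  obtain ⟨rfl, rfl, rfl⟩ := e
  set a := (pairIndex n q).a₁
  set b := (pairIndex n q).a₂
  set j := (pairIndex n q).j₃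
  have hp (p : ℕ × ℕ) (hp : p ∈ Q) : 0 < p.1.gcd p.2 ∧ p = (a * p.1.gcd p.2, b * p.1.gcd p.2) ∧
      p.1.gcd p.2 ≤ n / (a * b * j) ∧ (pairIndex n p).j₃ = j := by
    obtain ⟨hg, -, -, hc, e⟩ := eq_mul_of_mem_pairs (hQ hp)
    have hcore := hu p hp
    simp only [Index.core, Prod.mk.injEq] at hcore
    obtain ⟨e₁, e₂, e₃⟩ := hcore
    rw [e₁, e₂] at e hc
    refine ⟨hg, e, ?_, e₃⟩
    rw [Nat.le_div_iff_mul_le (by positivity)]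
    have h3 : n / p.1.lcm p.2 = j := e₃
    have hl : p.1.lcm p.2 = a * b * p.1.gcd p.2 := by
      conv_lhs => rw [e]
      exact lcm_mul_of_coprime hc
    have := Nat.div_mul_le_self n (p.1.lcm p.2)
    rw [h3, hl] at this
    linarith
  set M := n / (a * b * j) with hM
  have hinj : Set.InjOn (fun p : ℕ × ℕ => p.1.gcd p.2) Q := by
    intro p h p' h' (hpp : p.1.gcd p.2 = p'.1.gcd p'.2)
    rw [(hp p h).2.1, (hp p' h').2.1, hpp]
  have hcard : Q.card ≤ M := by
    rw [← Finset.card_image_of_injOn hinj]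
    have : Q.image (fun p : ℕ × ℕ => p.1.gcd p.2) ⊆ Finset.Icc 1 M := by
      intro m hm
      obtain ⟨p, hpQ, rfl⟩ := Finset.mem_image.1 hm
      exact Finset.mem_Icc.2 ⟨(hp p hpQ).1, (hp p hpQ).2.2.1⟩
    simpa using Finset.card_le_card this
  have hM' : (M : ℝ) ≤ n / (a * b * j) := by
    rw [hM]
    refine Nat.cast_div_le.trans ?_
    push_cast
    rfl
  have hterm (p : ℕ × ℕ) (h : p ∈ Q) :
      totientProd p * (pairIndex n p).weight α ≤ (a * b * (M : ℝ) ^ 2) * (α * j) := by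
    obtain ⟨-, e, hle, e₃⟩ := hp p h
    have hw : (pairIndex n p).weight α ≤ α * j := by
      have := weight_le h0 h1 (pairIndex n p).j₁ (pairIndex n p).j₂ (pairIndex n p).j₃
      rw [e₃] at this
      rwa [Index.weight, e₃]
    have ht : totientProd p ≤ a * b * (M : ℝ) ^ 2 := by
      have h₁ : p.1.totient ≤ a * M := by
        refine (Nat.totient_le _).trans ?_
        rw [(Prod.ext_iff.1 e).1]
        exact Nat.mul_le_mul_left _ hle
      have h₂ : p.2.totient ≤ b * M := by
        refine (Nat.totient_le _).trans ?_
        rw [(Prod.ext_iff.1 e).2]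
        exact Nat.mul_le_mul_left _ hle
      calc totientProd p ≤ ((a * M : ℕ) : ℝ) * ((b * M : ℕ) : ℝ) := by
            unfold totientProd
            gcongr
        _ = _ := by push_cast; ring
    exact mul_le_mul ht hw (weight_nonneg h0 h1 _ _ _) (by positivity)
  calc _ ≤ Q.card • ((a * b * (M : ℝ) ^ 2) * (α * j)) := Finset.sum_le_card_nsmul _ _ _ hterm
    _ = (Q.card : ℝ) * ((a * b * (M : ℝ) ^ 2) * (α * j)) := nsmul_eq_mul _ _
    _ ≤ (M : ℝ) * ((a * b * (M : ℝ) ^ 2) * (α * j)) := by gcongr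
    _ = α * (a * b * j) * (M : ℝ) ^ 3 := by ring
    _ ≤ α * (a * b * j) * ((n : ℝ) / (a * b * j)) ^ 3 := by gcongr
    _ = α * (n : ℝ) ^ 3 * coreBound (a, b, j) := by
      simp only [coreBound]
      field_simp

theorem sum_pairs_le {n : ℕ} {α : ℝ} (h0 : 0 ≤ α) (h1 : α ≤ 1) {Q : Finset (ℕ × ℕ)}
    (hQ : Q ⊆ pairs n) {U : Finset (ℕ × ℕ × ℕ)} (hU : ∀ p ∈ Q, (pairIndex n p).core ∈ U) :
    ∑ p ∈ Q, totientProd p * (pairIndex n p).weight α ≤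
      α * (n : ℝ) ^ 3 * ∑ u ∈ U, coreBound u := by
  rw [← Finset.sum_fiberwise_of_maps_to hU, Finset.mul_sum]
  exact Finset.sum_le_sum fun u _ => sum_core_le h0 h1 ((Finset.filter_subset _ _).trans hQ) u
    fun p hp => (Finset.mem_filter.1 hp).2

/-- The sum of `φ(d) φ(e)` times the weight over all pairs: up to the terms with `d = 1` or `e = 1`,
this is the variance. -/
def pairSum (n : ℕ) (α : ℝ) : ℝ := ∑ p ∈ pairs n, totientProd p * (pairIndex n p).weight α

theorem variance_eq_sum_pairs {Ω : Type*} [MeasurableSpace Ω] {P : Measure Ω}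
    [IsProbabilityMeasure P] {n : ℕ} {α : unitInterval} {𝒜 : Ω → Set ℕ} (h : IsModel n α 𝒜 P) :
    Var[fun ω => (degLcm (𝒜 ω) : ℝ); P] =
      ∑ p ∈ pairs n with 2 ≤ p.1 ∧ 2 ≤ p.2, totientProd p * (pairIndex n p).weight α := by
  rw [variance_degLcm h, ← Finset.sum_product']
  symm
  refine Finset.sum_subset ?_ ?_
  · intro p hp
    simp only [pairs, Finset.mem_filter, Finset.mem_product, Finset.mem_Icc] at hp ⊢
    omega
  · intro p hp hp'
    have : n / p.1.lcm p.2 = 0 := by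
      refine Nat.div_eq_of_lt ?_
      by_contra! hle
      refine hp' ?_
      simp only [pairs, Finset.mem_filter, Finset.mem_product, Finset.mem_Icc] at hp ⊢
      omega
    simp [pairIndex, Index.weight, this, weight]

theorem variance_le_pairSum {Ω : Type*} [MeasurableSpace Ω] {P : Measure Ω}
    [IsProbabilityMeasure P] {n : ℕ} {α : unitInterval} {𝒜 : Ω → Set ℕ} (h : IsModel n α 𝒜 P) :
    Var[fun ω => (degLcm (𝒜 ω) : ℝ); P] ≤ pairSum n α := by
  rw [variance_eq_sum_pairs h]
  exact Finset.sum_le_sum_of_subset_of_nonneg (Finset.filter_subset _ _) fun p _ _ =>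
    mul_nonneg (totientProd_nonneg p) (weight_nonneg α.2.1 α.2.2 _ _ _)

/-- There are at most `2 n` pairs with `d = 1` or `e = 1`, and `φ(d) φ(e) ≤ n` for each. -/
theorem pairSum_sub_variance_le {Ω : Type*} [MeasurableSpace Ω] {P : Measure Ω}
    [IsProbabilityMeasure P] {n : ℕ} {α : unitInterval} {𝒜 : Ω → Set ℕ} (h : IsModel n α 𝒜 P) :
    pairSum n α - Var[fun ω => (degLcm (𝒜 ω) : ℝ); P] ≤ 2 * (n : ℝ) ^ 2 := by
  rw [variance_eq_sum_pairs h, pairSum,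
    ← Finset.sum_filter_add_sum_filter_not (pairs n) (fun p => 2 ≤ p.1 ∧ 2 ≤ p.2),
    add_sub_cancel_left]
  set Q := {p ∈ pairs n | ¬(2 ≤ p.1 ∧ 2 ≤ p.2)} with hQ
  have hmem (p : ℕ × ℕ) (hp : p ∈ Q) :
      p.1 ∈ Finset.Icc 1 n ∧ p.2 ∈ Finset.Icc 1 n ∧ (p.1 = 1 ∨ p.2 = 1) := by
    simp only [hQ, pairs, Finset.mem_filter, Finset.mem_product, Finset.mem_Icc] at hp ⊢
    omega
  have hcard : Q.card ≤ 2 * n := by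
    have : Q ⊆ {1} ×ˢ Finset.Icc 1 n ∪ Finset.Icc 1 n ×ˢ {1} := by
      intro p hp
      have := hmem p hp
      simp only [Finset.mem_union, Finset.mem_product, Finset.mem_singleton]
      tauto
    refine (Finset.card_le_card this).trans ((Finset.card_union_le _ _).trans ?_)
    simp
    omega
  have hterm (p : ℕ × ℕ) (hp : p ∈ Q) :
      totientProd p * (pairIndex n p).weight α ≤ n := by
    have hpn := hmem p hp
    simp only [Finset.mem_Icc] at hpn
    have h1 : p.1.totient * p.2.totient ≤ n := by
      have t1 := Nat.totient_le p.1
      have t2 := Nat.totient_le p.2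
      rcases hpn.2.2 with e | e
      · rw [e, Nat.totient_one, one_mul]
        omega
      · rw [e, Nat.totient_one, mul_one]
        omega
    have h2 : totientProd p ≤ n := by
      unfold totientProd
      exact_mod_cast h1
    exact (mul_le_of_le_one_right (totientProd_nonneg p)
      (weight_le_one α.2.1 α.2.2 _ _ _)).trans h2
  calc _ ≤ Q.card • (n : ℝ) := Finset.sum_le_card_nsmul _ _ _ hterm
    _ = (Q.card : ℝ) * n := nsmul_eq_mul _ _
    _ ≤ ((2 * n : ℕ) : ℝ) * n := by gcongr
    _ = _ := by push_cast; ring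

/-! ### The limiting variance -/

theorem varTerm_eq (α : ℝ) (t : Index) :
    varTerm α t = t.weight α * (C₁ t.a₁ t.a₂ * (ρ₂ t ^ 3 - ρ₁ t ^ 3)) := rfl

theorem Index.weight_nonneg {α : ℝ} (h0 : 0 ≤ α) (h1 : α ≤ 1) (t : Index) : 0 ≤ t.weight α :=
  QLcm.weight_nonneg h0 h1 _ _ _

theorem varTerm_nonneg {α : ℝ} (h0 : 0 ≤ α) (h1 : α ≤ 1) {t : Index} (ht : t ∈ indexSet) :
    0 ≤ varTerm α t := by
  rw [varTerm_eq]
  refine mul_nonneg (Index.weight_nonneg h0 h1 t) (ge_of_tendsto' (tendsto_fiberSum ht) fun n => ?_)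
  have := fiberSum_nonneg n t
  positivity

open scoped Classical in
theorem sum_weight_mul_fiberSum (n : ℕ) (α : ℝ) (T : Finset Index) :
    ∑ t ∈ T, t.weight α * fiberSum n t =
      ∑ p ∈ pairs n with pairIndex n p ∈ T, totientProd p * (pairIndex n p).weight α := by
  rw [← Finset.sum_fiberwise_of_maps_to (s := {p ∈ pairs n | pairIndex n p ∈ T}) (t := T)
    (g := pairIndex n) fun p hp => (Finset.mem_filter.1 hp).2]
  refine Finset.sum_congr rfl fun t ht => ?_
  rw [fiberSum, Finset.mul_sum, Finset.filter_filter]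
  have : {p ∈ pairs n | pairIndex n p ∈ T ∧ pairIndex n p = t} =
      {p ∈ pairs n | pairIndex n p = t} := by
    refine Finset.filter_congr fun p _ => ⟨fun h => h.2, fun h => ⟨h ▸ ht, h⟩⟩
  rw [this]
  refine Finset.sum_congr rfl fun p hp => ?_
  rw [(Finset.mem_filter.1 hp).2, mul_comm]

/-- The domination passes to the limit, index by index. -/
theorem sum_varTerm_le {α : ℝ} (h0 : 0 ≤ α) (h1 : α ≤ 1) (T : Finset indexSet)
    {U : Finset (ℕ × ℕ × ℕ)} (hU : ∀ t ∈ T, (t : Index).core ∈ U) :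
    ∑ t ∈ T, varTerm α t ≤ ∑ u ∈ U, coreBound u := by
  classical
  set T' : Finset Index := T.map (Function.Embedding.subtype _)
  have hT {t : Index} (ht : t ∈ T') : t ∈ indexSet ∧ t.core ∈ U := by
    obtain ⟨t', ht', rfl⟩ := Finset.mem_map.1 ht
    exact ⟨t'.2, hU t' ht'⟩
  have e : ∑ t ∈ T, varTerm α t = ∑ t ∈ T', varTerm α t := by
    rw [Finset.sum_map]
    rfl
  rw [e]
  have hlim : Tendsto (fun n : ℕ => ∑ t ∈ T', t.weight α * (fiberSum n t / (n : ℝ) ^ 3)) atTop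
      (𝓝 (∑ t ∈ T', varTerm α t)) :=
    tendsto_finsetSum _ fun t ht => (tendsto_fiberSum (hT ht).1).const_mul _
  refine le_of_tendsto hlim ?_
  filter_upwards [eventually_gt_atTop 0] with n hn
  have hs : 0 ≤ ∑ u ∈ U, coreBound u := Finset.sum_nonneg fun u _ => coreBound_nonneg u
  simp only [← mul_div_assoc]
  rw [← Finset.sum_div, sum_weight_mul_fiberSum, div_le_iff₀ (by positivity)]
  refine (sum_pairs_le h0 h1 (Finset.filter_subset _ _)
    fun p hp => (hT (Finset.mem_filter.1 hp).2).2).trans ?_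
  calc α * (n : ℝ) ^ 3 * ∑ u ∈ U, coreBound u ≤ 1 * (n : ℝ) ^ 3 * ∑ u ∈ U, coreBound u := by
        gcongr
    _ = _ := by ring

theorem summable_varTerm {α : ℝ} (h0 : 0 ≤ α) (h1 : α ≤ 1) :
    Summable fun t : indexSet => varTerm α t := by
  classical
  refine summable_of_sum_le (c := ∑' u, coreBound u) (fun t => varTerm_nonneg h0 h1 t.2) fun T => ?_
  exact (sum_varTerm_le h0 h1 T (U := T.image fun t : indexSet => (t : Index).core)
    fun t ht => Finset.mem_image_of_mem _ ht).trans
      (summable_coreBound.sum_le_tsum _ fun u _ => coreBound_nonneg u)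

/-- The indices with given `a₁`, `a₂`, `j₃` are finite in number: `ρ₁ < ρ₂` forces
`j₁ < a₂ (j₃ + 1)` and `j₂ < a₁ (j₃ + 1)`. -/
theorem finite_core_mem (U : Finset (ℕ × ℕ × ℕ)) : {t ∈ indexSet | t.core ∈ U}.Finite := by
  refine Set.Finite.subset (s := ⋃ u ∈ U, (fun j : ℕ × ℕ => (⟨u.1, u.2.1, j.1, j.2, u.2.2⟩ : Index)) ''
    (Set.Iio (u.2.1 * (u.2.2 + 1)) ×ˢ Set.Iio (u.1 * (u.2.2 + 1)))) ?_ ?_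
  · exact U.finite_toSet.biUnion fun u _ => ((Set.finite_Iio _).prod (Set.finite_Iio _)).image _
  · rintro t ⟨⟨h₁, h₂, k₁, k₂, k₃, -, hρ⟩, htU⟩
    refine Set.mem_biUnion htU ⟨(t.j₁, t.j₂), ⟨?_, ?_⟩, rfl⟩
    · have h : 1 / ((t.a₁ : ℝ) * t.a₂ * (t.j₃ + 1)) < 1 / ((t.a₁ : ℝ) * t.j₁) :=
        ((le_max_right _ _).trans (le_max_right _ _)).trans_lt (hρ.trans_le (min_le_left _ _))
      rw [one_div_lt_one_div (by positivity) (by positivity)] at h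
      norm_cast at h
      rw [mul_assoc] at h
      exact lt_of_mul_lt_mul_left h h₁.le
    · have h : 1 / ((t.a₁ : ℝ) * t.a₂ * (t.j₃ + 1)) < 1 / ((t.a₂ : ℝ) * t.j₂) :=
        ((le_max_right _ _).trans (le_max_right _ _)).trans_lt
          (hρ.trans_le ((min_le_right _ _).trans (min_le_left _ _)))
      rw [one_div_lt_one_div (by positivity) (by positivity)] at h
      norm_cast at h
      rw [mul_comm t.a₁, mul_assoc] at h
      exact lt_of_mul_lt_mul_left h h₂.le

/-- The normalized sum over pairs converges to the limiting variance, uniformly in `α`. -/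
theorem pairSum_sub_tsum_le {ε : ℝ} (hε : 0 < ε) :
    ∀ᶠ n : ℕ in atTop, ∀ α : ℝ, 0 ≤ α → α ≤ 1 →
      |pairSum n α - (∑' t : indexSet, varTerm α t) * (n : ℝ) ^ 3| ≤ ε * (n : ℝ) ^ 3 := by
  classical
  obtain ⟨U, hU⟩ := summable_iff_vanishing_norm.1 summable_coreBound (ε / 4) (by positivity)
  have hU' (V : Finset (ℕ × ℕ × ℕ)) (hV : Disjoint V U) : ∑ u ∈ V, coreBound u ≤ ε / 4 :=
    (le_abs_self _).trans (hU V hV).le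
  set F : Finset Index := (finite_core_mem U).toFinset with hF
  have hFmem {t : Index} : t ∈ F ↔ t ∈ indexSet ∧ t.core ∈ U := by
    rw [hF, Set.Finite.mem_toFinset]
    rfl
  -- on the finite set `F` the convergence is uniform because the weights are at most `1`
  have hlim : Tendsto (fun n : ℕ => ∑ t ∈ F,
      |fiberSum n t / (n : ℝ) ^ 3 - C₁ t.a₁ t.a₂ * (ρ₂ t ^ 3 - ρ₁ t ^ 3)|) atTop (𝓝 0) := by
    rw [← Finset.sum_const_zero (s := F)]
    refine tendsto_finsetSum _ fun t ht => ?_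
    have := (tendsto_fiberSum (hFmem.1 ht).1).sub_const (C₁ t.a₁ t.a₂ * (ρ₂ t ^ 3 - ρ₁ t ^ 3))
    rw [sub_self] at this
    simpa using this.abs
  filter_upwards [eventually_gt_atTop 0, hlim.eventually_lt_const (show 0 < ε / 4 by positivity)]
    with n hn hn' α h0 h1
  have hn3 : (0 : ℝ) < (n : ℝ) ^ 3 := by positivity
  have hmain : |∑ t ∈ F, t.weight α * fiberSum n t - (∑ t ∈ F, varTerm α t) * (n : ℝ) ^ 3| ≤
      ε / 4 * (n : ℝ) ^ 3 := by
    have e : ∑ t ∈ F, t.weight α * fiberSum n t - (∑ t ∈ F, varTerm α t) * (n : ℝ) ^ 3 =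
        (∑ t ∈ F, t.weight α *
          (fiberSum n t / (n : ℝ) ^ 3 - C₁ t.a₁ t.a₂ * (ρ₂ t ^ 3 - ρ₁ t ^ 3))) * (n : ℝ) ^ 3 := by
      rw [Finset.sum_mul, Finset.sum_mul, ← Finset.sum_sub_distrib]
      refine Finset.sum_congr rfl fun t _ => ?_
      rw [varTerm_eq]
      field_simp
    rw [e, abs_mul, abs_of_pos hn3]
    gcongr
    refine ((Finset.abs_sum_le_sum_abs _ _).trans (Finset.sum_le_sum fun t _ => ?_)).trans hn'.le
    rw [abs_mul, abs_of_nonneg (Index.weight_nonneg h0 h1 t)]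
    exact mul_le_of_le_one_left (abs_nonneg _) (weight_le_one h0 h1 _ _ _)
  have htail : pairSum n α - ∑ t ∈ F, t.weight α * fiberSum n t ≤ ε / 4 * (n : ℝ) ^ 3 ∧
      0 ≤ pairSum n α - ∑ t ∈ F, t.weight α * fiberSum n t := by
    rw [sum_weight_mul_fiberSum, pairSum,
      ← Finset.sum_filter_add_sum_filter_not (pairs n) (fun p => pairIndex n p ∈ F),
      add_sub_cancel_left]
    refine ⟨?_, Finset.sum_nonneg fun p _ =>
      mul_nonneg (totientProd_nonneg p) (Index.weight_nonneg h0 h1 _)⟩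
    set Q := {p ∈ pairs n | pairIndex n p ∉ F} with hQ
    have h := sum_pairs_le h0 h1 (Finset.filter_subset _ _ : Q ⊆ pairs n)
      (U := Q.image fun p => (pairIndex n p).core) fun p hp => Finset.mem_image_of_mem _ hp
    have hd : Disjoint (Q.image fun p => (pairIndex n p).core) U := by
      rw [Finset.disjoint_left]
      intro u hu hu'
      obtain ⟨p, hp, rfl⟩ := Finset.mem_image.1 hu
      obtain ⟨hp1, hp2⟩ := Finset.mem_filter.1 hp
      exact hp2 (hFmem.2 ⟨pairIndex_mem hp1, hu'⟩)
    refine h.trans ?_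
    calc _ ≤ 1 * (n : ℝ) ^ 3 * (ε / 4) := by
          have hs := Finset.sum_nonneg fun u (_ : u ∈ Q.image fun p => (pairIndex n p).core) =>
            coreBound_nonneg u
          have := hU' _ hd
          gcongr
      _ = _ := by ring
  have hts : ∑ t ∈ F, varTerm α t ≤ ∑' t : indexSet, varTerm α t ∧
      ∑' t : indexSet, varTerm α t ≤ ∑ t ∈ F, varTerm α t + ε / 4 := by
    have hnn (t : indexSet) : 0 ≤ varTerm α t := varTerm_nonneg h0 h1 t.2
    have eF : ∑ t ∈ F, varTerm α t = ∑ t ∈ F.subtype (· ∈ indexSet), varTerm α t :=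
      (Finset.sum_subtype_of_mem (varTerm α) fun t ht => (hFmem.1 ht).1).symm
    refine ⟨?_, ?_⟩
    · rw [eF]
      exact (summable_varTerm h0 h1).sum_le_tsum _ fun t _ => hnn t
    · refine (summable_varTerm h0 h1).tsum_le_of_sum_le fun T => ?_
      rw [← Finset.sum_filter_add_sum_filter_not T (fun t : indexSet => (t : Index) ∈ F), eF]
      refine add_le_add (Finset.sum_le_sum_of_subset_of_nonneg ?_ fun t _ _ => hnn t) ?_
      · intro t ht
        rw [Finset.mem_subtype]
        exact (Finset.mem_filter.1 ht).2
      · refine (sum_varTerm_le h0 h1 _ (U := (T.filter fun t : indexSet => ¬(t : Index) ∈ F).image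
          fun t : indexSet => (t : Index).core) fun t ht => Finset.mem_image_of_mem _ ht).trans
            (hU' _ ?_)
        rw [Finset.disjoint_left]
        intro u hu hu'
        obtain ⟨t, ht, rfl⟩ := Finset.mem_image.1 hu
        exact (Finset.mem_filter.1 ht).2 (hFmem.2 ⟨t.2, hu'⟩)
  have hts1 := mul_le_mul_of_nonneg_right hts.1 hn3.le
  have hts2 := mul_le_mul_of_nonneg_right hts.2 hn3.le
  rw [abs_le] at hmain ⊢
  constructor <;> nlinarith

/-! ### Positivity -/

/-- Summing `m = ∑_{d ∣ m} φ(d)` over `m ≤ N` shows that `φ(d) / d` is at least `1 / 2` on average. -/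
theorem le_sum_totient_div (N : ℕ) :
    (N : ℝ) / 2 ≤ ∑ d ∈ Finset.Icc 1 N, (d.totient : ℝ) / d := by
  have h1 : ∑ m ∈ Finset.Icc 1 N, m = ∑ d ∈ Finset.Icc 1 N, d.totient * (N / d) := by
    calc ∑ m ∈ Finset.Icc 1 N, m
        = ∑ m ∈ Finset.Icc 1 N, ∑ d ∈ Finset.Icc 1 N, if d ∣ m then d.totient else 0 := by
          refine Finset.sum_congr rfl fun m hm => ?_
          rw [Finset.mem_Icc] at hm
          conv_lhs => rw [← Nat.sum_totient m]
          rw [← Finset.sum_filter]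
          refine Finset.sum_congr ?_ fun _ _ => rfl
          ext d
          simp only [Nat.mem_divisors, Finset.mem_filter, Finset.mem_Icc]
          constructor
          · rintro ⟨hd, -⟩
            have := Nat.pos_of_dvd_of_pos hd hm.1
            have := Nat.le_of_dvd hm.1 hd
            exact ⟨by omega, hd⟩
          · rintro ⟨-, hd⟩
            exact ⟨hd, by omega⟩
      _ = _ := by
          rw [Finset.sum_comm]
          refine Finset.sum_congr rfl fun d _ => ?_
          rw [← Finset.sum_filter, Finset.sum_const, smul_eq_mul, mul_comm,
            ← Nat.Ioc_filter_dvd_card_eq_div]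
          rfl
  have h2 : (N : ℝ) * (N + 1) / 2 = ∑ m ∈ Finset.Icc 1 N, (m : ℝ) := by
    clear h1
    induction N with
    | zero => simp
    | succ N ih =>
      rw [Finset.sum_Icc_succ_top (by omega), ← ih]
      push_cast
      ring
  have h3 : ∑ m ∈ Finset.Icc 1 N, (m : ℝ) ≤ N * ∑ d ∈ Finset.Icc 1 N, (d.totient : ℝ) / d := by
    rw [← Nat.cast_sum, h1, Nat.cast_sum, Finset.mul_sum]
    refine Finset.sum_le_sum fun d _ => ?_
    rw [Nat.cast_mul]
    calc (d.totient : ℝ) * ((N / d : ℕ) : ℝ) ≤ d.totient * ((N : ℝ) / d) := by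
          gcongr
          exact Nat.cast_div_le
      _ = _ := by ring
  rcases N.eq_zero_or_pos with rfl | hN
  · simp
  have hN' : (0 : ℝ) < N := by exact_mod_cast hN
  nlinarith

theorem le_totientSum_one (N : ℕ) : (N : ℝ) ^ 3 / 256 ≤ totientSum 1 1 N := by
  -- with `x = φ(d) / d ∈ [0, 1]`, use `x² ≥ x / 2 - 1 / 16` for `d ≥ N / 4`, and drop the other `d`
  have hterm (d : ℕ) (hd : d ∈ Finset.Icc 1 N) :
      (N : ℝ) ^ 2 / 16 * ((d.totient : ℝ) / d / 2 - 1 / 16 - if 4 * d ≤ N then 7 / 16 else 0) ≤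
        ((1 * d).totient : ℝ) * ((1 * d).totient : ℝ) := by
    have hd0 : 0 < d := (Finset.mem_Icc.1 hd).1
    have hdR : (0 : ℝ) < d := by exact_mod_cast hd0
    have hx1 : (d.totient : ℝ) / d ≤ 1 := by
      rw [div_le_one hdR]
      exact_mod_cast Nat.totient_le d
    have e : ((1 * d).totient : ℝ) * ((1 * d).totient : ℝ) =
        (d : ℝ) ^ 2 * ((d.totient : ℝ) / d) ^ 2 := by
      rw [one_mul]
      field_simp
    rw [e]
    set x := (d.totient : ℝ) / d
    split_ifs with h
    · have : (N : ℝ) ^ 2 / 16 * (x / 2 - 1 / 16 - 7 / 16) ≤ 0 :=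
        mul_nonpos_of_nonneg_of_nonpos (by positivity) (by linarith)
      exact this.trans (by positivity)
    · have h4 : (N : ℝ) ≤ 4 * d := by exact_mod_cast (not_le.1 h).le
      have hsq : (N : ℝ) ^ 2 / 16 ≤ (d : ℝ) ^ 2 := by nlinarith [(N.cast_nonneg : (0 : ℝ) ≤ N)]
      calc (N : ℝ) ^ 2 / 16 * (x / 2 - 1 / 16 - 0) ≤ (N : ℝ) ^ 2 / 16 * x ^ 2 := by
            gcongr
            nlinarith [sq_nonneg (x - 1 / 4)]
        _ ≤ (d : ℝ) ^ 2 * x ^ 2 := by gcongr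
  have hcard : ((Finset.card {d ∈ Finset.Icc 1 N | 4 * d ≤ N} : ℕ) : ℝ) ≤ N / 4 := by
    have : {d ∈ Finset.Icc 1 N | 4 * d ≤ N} ⊆ Finset.Icc 1 (N / 4) := by
      intro d hd
      simp only [Finset.mem_filter, Finset.mem_Icc] at hd ⊢
      omega
    have h := Finset.card_le_card this
    rw [Nat.card_Icc, Nat.add_sub_cancel] at h
    calc _ ≤ ((N / 4 : ℕ) : ℝ) := by exact_mod_cast h
      _ ≤ _ := by exact_mod_cast Nat.cast_div_le (α := ℝ) (m := N) (n := 4)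
  refine le_trans ?_ (Finset.sum_le_sum hterm)
  rw [← Finset.mul_sum, Finset.sum_sub_distrib, Finset.sum_sub_distrib, ← Finset.sum_div,
    ← Finset.sum_filter, Finset.sum_const, Finset.sum_const, nsmul_eq_mul, nsmul_eq_mul,
    Nat.card_Icc, Nat.add_sub_cancel]
  have := le_sum_totient_div N
  calc (N : ℝ) ^ 3 / 256 = (N : ℝ) ^ 2 / 16 * (N / 16) := by ring
    _ ≤ _ := by
      gcongr
      linarith

theorem C₁_one_one_pos : 0 < C₁ 1 1 := by
  have h : (1 : ℝ) / 256 ≤ C₁ 1 1 := by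
    refine ge_of_tendsto (tendsto_totientSum one_pos one_pos) ?_
    filter_upwards [eventually_gt_atTop 0] with N hN
    rw [le_div_iff₀ (by positivity)]
    linarith [le_totientSum_one N]
  linarith

theorem tsum_varTerm_pos {α : ℝ} (hα : α ∈ Set.Ioo (0 : ℝ) 1) :
    0 < ∑' t : indexSet, varTerm α t := by
  set t : Index := ⟨1, 1, 1, 1, 1⟩ with ht
  have h1 : ρ₁ t = 1 / 2 := by norm_num [ρ₁, ht]
  have h2 : ρ₂ t = 1 := by norm_num [ρ₂, ht]
  have hmem : t ∈ indexSet := by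
    refine ⟨one_pos, one_pos, one_pos, one_pos, one_pos, Nat.coprime_one_left 1, ?_⟩
    rw [h1, h2]
    norm_num
  refine (summable_varTerm hα.1.le hα.2.le).tsum_pos (fun s => varTerm_nonneg hα.1.le hα.2.le s.2)
    ⟨t, hmem⟩ ?_
  rw [varTerm_eq, h1, h2]
  have hw : 0 < t.weight α := by
    have := hα.1
    have : 0 < 1 - α := by linarith [hα.2]
    simp only [Index.weight, weight, ht]
    norm_num
    positivity
  have := C₁_one_one_pos
  have e : C₁ t.a₁ t.a₂ = C₁ 1 1 := rfl
  rw [e]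
  norm_num
  positivity

end QLcm

theorem theorem3 :
    -- the double series that define the numbers `C₁(a₁, a₂)` converge absolutely
    (∀ a₁ a₂ : ℕ, 0 < a₁ → 0 < a₂ → Summable (QLcm.C₁Term a₁ a₂)) ∧
    -- the function `v`, positive on `(0,1)` and given by a convergent series, and the asymptotics
    (∃ v : ℝ → ℝ,
      (∀ α ∈ Set.Ioo (0 : ℝ) 1,
        0 < v α ∧ HasSum (fun t : QLcm.indexSet => QLcm.varTerm α (t : QLcm.Index)) (v α)) ∧
      ∀ ε : ℝ, 0 < ε → ∃ K : ℝ, ∀ (n : ℕ) (α : unitInterval), 3 ≤ n → 0 < (α : ℝ) → (α : ℝ) < 1 →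
        K ≤ (α : ℝ) * n / (Real.log n ^ 3 * Real.log (Real.log n)) →
        ∀ {Ω : Type*} [MeasurableSpace Ω] (P : Measure Ω) [IsProbabilityMeasure P]
          (𝒜 : Ω → Set ℕ), QLcm.IsModel n α 𝒜 P →
          |Var[fun ω => (QLcm.degLcm (𝒜 ω) : ℝ); P] - v α * (n : ℝ) ^ 3| ≤ ε * (n : ℝ) ^ 3) ∧
    -- the uniform upper bound
    (∃ C : ℝ, ∀ (n : ℕ) (α : unitInterval), 1 ≤ n →
      ∀ {Ω : Type*} [MeasurableSpace Ω] (P : Measure Ω) [IsProbabilityMeasure P]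
        (𝒜 : Ω → Set ℕ), QLcm.IsModel n α 𝒜 P →
        Var[fun ω => (QLcm.degLcm (𝒜 ω) : ℝ); P] ≤ C * (α : ℝ) * (n : ℝ) ^ 3) := by
  refine ⟨fun a₁ a₂ h₁ h₂ => QLcm.summable_C₁Term h₁ h₂,
    ⟨fun α => ∑' t : QLcm.indexSet, QLcm.varTerm α t, fun α hα => ⟨QLcm.tsum_varTerm_pos hα,
      (QLcm.summable_varTerm hα.1.le hα.2.le).hasSum⟩, fun ε hε => ?_⟩,
    ⟨∑' u, QLcm.coreBound u, fun n α _ Ω _ P _ 𝒜 h => ?_⟩⟩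
  · obtain ⟨N₁, hN₁⟩ :=
      Filter.eventually_atTop.1 (QLcm.pairSum_sub_tsum_le (show 0 < ε / 2 by positivity))
    obtain ⟨N₂, hN₂⟩ := exists_nat_gt (4 / ε)
    set N := max N₁ N₂
    -- a lower bound for `α n / ((log n)³ log log n)` that no `n < N` can reach
    set r : ℕ → ℝ := fun n => n / (Real.log n ^ 3 * Real.log (Real.log n))
    refine ⟨1 + ∑ n ∈ Finset.range N, |r n|, fun n α hn hα0 hα1 hK Ω _ P _ 𝒜 h => ?_⟩
    have hnN : N ≤ n := by
      by_contra! hlt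
      have h1 : (α : ℝ) * n / (Real.log n ^ 3 * Real.log (Real.log n)) = α * r n :=
        mul_div_assoc _ _ _
      have h2 : (α : ℝ) * r n ≤ |r n| := by
        refine (le_abs_self _).trans ?_
        rw [abs_mul, abs_of_pos hα0]
        exact mul_le_of_le_one_left (abs_nonneg _) hα1.le
      have h3 : |r n| ≤ ∑ n ∈ Finset.range N, |r n| :=
        Finset.single_le_sum (f := fun n => |r n|) (fun _ _ => abs_nonneg _)
          (Finset.mem_range.2 hlt)
      linarith
    have hmain := hN₁ n ((le_max_left _ _).trans hnN) α hα0.le hα1.le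
    have hle := QLcm.variance_le_pairSum h
    have hge := QLcm.pairSum_sub_variance_le h
    have hn2 : 2 * (n : ℝ) ^ 2 ≤ ε / 2 * (n : ℝ) ^ 3 := by
      have h4 : 4 / ε < n := hN₂.trans_le (by exact_mod_cast (le_max_right _ _).trans hnN)
      rw [div_lt_iff₀ hε] at h4
      nlinarith [sq_nonneg (n : ℝ)]
    rw [abs_le] at hmain ⊢
    constructor <;> linarith
  · have hs := QLcm.sum_pairs_le α.2.1 α.2.2 (Finset.Subset.refl (QLcm.pairs n))
      (U := (QLcm.pairs n).image fun p => (QLcm.pairIndex n p).core)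
      fun p hp => Finset.mem_image_of_mem _ hp
    have ht := QLcm.summable_coreBound.sum_le_tsum
      ((QLcm.pairs n).image fun p => (QLcm.pairIndex n p).core) fun u _ => QLcm.coreBound_nonneg u
    have hα := α.2.1
    calc _ ≤ QLcm.pairSum n α := QLcm.variance_le_pairSum h
      _ ≤ _ := hs
      _ ≤ (α : ℝ) * (n : ℝ) ^ 3 * ∑' u, QLcm.coreBound u := by gcongr
      _ = _ := by ring
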